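/- Let $\mathrm{Ch}$ be the category of cochain complexes of $\mathbb{Q}$-vector spaces in degrees $\ge 0$, and let $p\mathrm{Ch}=\mathrm{Fun}([0,\infty),\mathrm{Ch})$ be the category of persistent cochain complexes, where $[0,\infty)$ is regarded as a poset. For $k\ge 0$ let $S^k$ be $\mathbb{Q}$ in degree $k$; let $D^k$ (for $k\geq 1$) be $\mathbb{Q}\xrightarrow{=}\mathbb{Q}$ in degrees $k-1,k$, and $D^0=0$. For $0\le s\le t\le\infty$ let $\mathbb{S}^k_{[s,t)}$ be $0$ at indices $r<s$, $S^k$ at $s\le r<t$ and $D^k$ at $r\ge t$, and for $0\le s<\infty$ let $\mathbb{D}^k_s$ be $0$ at $r<s$ and $D^k$ at $r\ge s$, with the evident structure maps; put $\mathbb{D}^k_\infty=0$. The interval-sphere model structure on $p\mathrm{Ch}$ has the pointwise quasi-isomorphisms as weak equivalences and is cofibrantly generated by $$\mathbb{I}=\{\mathbb{S}^k_{[s,t)}\to\mathbb{D}^k_s \mid k\ge 0,\ 0\le s<t\le\infty\},\qquad \mathbb{J}=\{\mathbb{D}^k_t\to\mathbb{D}^k_s\mid k\ge 0,\ 0\le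 s<t\le\infty\};$$ thus its cofibrations are the maps with the left lifting property against every map that has the right lifting property against $\mathbb{I}$, and its fibrations are the maps with the right lifting property against $\mathbb{J}$. The injective model structure on $p\mathrm{Ch}$ has as weak equivalences and cofibrations the maps that are pointwise weak equivalences, respectively cofibrations, of the projective model structure on $\mathrm{Ch}$ (weak equivalences the quasi-isomorphisms, fibrations the degreewise surjections); its fibrations are the maps with the right lifting property against the maps that are both. A right-closed point of a persistence module $\mathbb{V}:[0,\infty)\to\mathrm{Vec}_{\mathbb{Q}}$ is a nonzero element $v\in\mathbb{V}(r)$, for some $r\geq 0$, with $\mathbb{V}(r\le r')(v)=0$ for all $r'>r$. Then: 1. If $\mathbb{Y}\in p\mathrm{Ch}$ and, for some $k>0$, the persistence module $\mathbb{Y}^k$ contains a right-closed point, then $\mathbb{Y}$ is not cofibrant in the interval-sphere model structure. 2. For all $0\le s\le t<\infty$ and $k>0$, the closed interval $\mathbb{I}_{[s,t]}\otimes S^k$ (the complex which in degree $k$ is $\mathbb{Q}$ at the indices in $[s,t]$ with identity structure maps, and is zero elsewhere) is not cofibrant in the interval-sphere model structure. 3. Every object of $p\mathrm{Ch}$ is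 cofibrant in the injective model structure. Consequently the interval-sphere and the injective model structures have different classes of cofibrations, and so they are different model structures. -/

import Mathlib

open CategoryTheory CategoryTheory.Limits
open scoped NNReal ENNReal ZeroObject

noncomputable section

namespace PersistentComplex

/-- Persistence modules: functors from the poset `[0, ∞)` to rational vector spaces. -/
abbrev PVec : Type 1 := ℝ≥0 ⥤ ModuleCat.{0} ℚ

/-- Cochain complexes of rational vector spaces in degrees `≥ 0`. -/
abbrev Ch : Type 1 := CochainComplex (ModuleCat.{0} ℚ) ℕ

/-- Persistent cochain complexes: functors from the poset `[0, ∞)` to cochain complexes. -/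
abbrev PCh : Type 1 := ℝ≥0 ⥤ Ch

/-- The persistence module `𝕐^k` of `k`-cochains of a persistent cochain complex `𝕐`. -/
def cochains (Y : PCh) (k : ℕ) : PVec :=
  Y ⋙ HomologicalComplex.eval (ModuleCat.{0} ℚ) (ComplexShape.up ℕ) k

/-- `v ∈ V(r)` is a right-closed point: it is nonzero and every structure map to a strictly
later index kills it. -/
def IsRightClosed (V : PVec) (r : ℝ≥0) (v : V.obj r) : Prop :=
  v ≠ 0 ∧ ∀ (r' : ℝ≥0) (h : r < r'), V.map (homOfLE h.le) v = 0

/-! ### Interval modules -/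

/-- The fibre at `r` of the interval module of `I`: it is `ℚ` if `r ∈ I`, and `0` otherwise. -/
def intervalFiber (I : Set ℝ≥0) (r : ℝ≥0) : Submodule ℚ ℚ where
  carrier := {q | r ∉ I → q = 0}
  zero_mem' := fun _ => rfl
  add_mem' := fun ha hb h => by rw [ha h, hb h, add_zero]
  smul_mem' := fun c x hx h => by rw [hx h, smul_zero]

open Classical in
/-- The map between two fibres (of possibly different interval modules) that is the identity
of `ℚ` if both fibres are `ℚ`, and zero otherwise. -/
def fiberMap (I J : Set ℝ≥0) (r r' : ℝ≥0) : intervalFiber I r →ₗ[ℚ] intervalFiber J r' where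
  toFun q := ⟨if r' ∈ J then q.1 else 0, fun h => if_neg h⟩
  map_add' a b := by
    ext
    by_cases h : r' ∈ J <;> simp [h]
  map_smul' c a := by
    ext
    by_cases h : r' ∈ J <;> simp [h]

lemma fiberMap_self (I : Set ℝ≥0) (r : ℝ≥0) : fiberMap I I r r = LinearMap.id := by
  apply LinearMap.ext
  intro q
  apply Subtype.ext
  by_cases h : r ∈ I
  · simp [fiberMap, h]
  · simp [fiberMap, h, q.2 h]

lemma fiberMap_comp {I J K : Set ℝ≥0} {r r' r'' : ℝ≥0} (h : r ∈ I → r'' ∈ K → r' ∈ J) :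
    fiberMap J K r' r'' ∘ₗ fiberMap I J r r' = fiberMap I K r r'' := by
  apply LinearMap.ext
  intro q
  apply Subtype.ext
  by_cases h'' : r'' ∈ K
  · by_cases h' : r' ∈ J
    · simp [fiberMap, h', h'']
    · simp [fiberMap, h', h'', q.2 (fun h1 => h' (h h1 h''))]
  · simp [fiberMap, h'']

/-- The interval module `𝕀_I` of an interval `I ⊆ [0, ∞)`: it is `ℚ` over the points of `I` and
`0` elsewhere; the structure maps between points of `I` are identities, the others are zero. -/
def intervalModule (I : Set ℝ≥0) (hI : I.OrdConnected) : PVec where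
  obj r := ModuleCat.of ℚ (intervalFiber I r)
  map {r r'} _ := ModuleCat.ofHom (fiberMap I I r r')
  map_id r := by rw [fiberMap_self]; rfl
  map_comp {r r' r''} f g := by
    rw [← ModuleCat.ofHom_comp,
      fiberMap_comp (fun h h'' => hI.out h h'' ⟨leOfHom f, leOfHom g⟩)]

/-- The ray `[t, ∞)` in `[0, ∞)`; it is empty for `t = ∞`. -/
def ray (t : ℝ≥0∞) : Set ℝ≥0 := {r | t ≤ (r : ℝ≥0∞)}

lemma ray_ordConnected (t : ℝ≥0∞) : (ray t).OrdConnected :=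
  ⟨fun _ hx _ _ _ hz => le_trans (show t ≤ _ from hx) (ENNReal.coe_le_coe.2 hz.1)⟩

/-- The half-open interval `[s, t)` in `[0, ∞)`, where `t = ∞` is allowed. -/
def halfOpen (s t : ℝ≥0∞) : Set ℝ≥0 := {r | s ≤ (r : ℝ≥0∞) ∧ (r : ℝ≥0∞) < t}

lemma halfOpen_ordConnected (s t : ℝ≥0∞) : (halfOpen s t).OrdConnected :=
  ⟨fun _ hx _ hy _ hz => ⟨le_trans (show s ≤ _ from hx.1) (ENNReal.coe_le_coe.2 hz.1),
    lt_of_le_of_lt (ENNReal.coe_le_coe.2 hz.2) (show _ < t from hy.2)⟩⟩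

/-- The free persistence module `𝕀_{[t, ∞)}`, which is zero for `t = ∞`. -/
def rayModule (t : ℝ≥0∞) : PVec := intervalModule (ray t) (ray_ordConnected t)

/-- The inclusion `𝕀_{[t, ∞)} ↪ 𝕀_{[s, ∞)}` for `s ≤ t ≤ ∞`. -/
def rayInclusion {s t : ℝ≥0∞} (hst : s ≤ t) : rayModule t ⟶ rayModule s where
  app r := ModuleCat.ofHom (fiberMap (ray t) (ray s) r r)
  naturality r r' f := by
    dsimp only [rayModule, intervalModule]
    rw [← ModuleCat.ofHom_comp, ← ModuleCat.ofHom_comp,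
      fiberMap_comp (J := ray t)
        (fun h _ => le_trans (show t ≤ _ from h) (ENNReal.coe_le_coe.2 (leOfHom f))),
      fiberMap_comp (J := ray s) (fun h _ => le_trans hst (show t ≤ _ from h))]

/-- The closed interval module `𝕀_{[s, t]}`. -/
def closedIntervalModule (s t : ℝ≥0) : PVec := intervalModule (Set.Icc s t) Set.ordConnected_Icc

/-- `V ⊗ S^k`: the persistent cochain complex with the persistence module `V` in degree `k` and
zero in all other degrees. -/
def tensorSphere (V : PVec) (k : ℕ) : PCh :=
  V ⋙ HomologicalComplex.single (ModuleCat.{0} ℚ) (ComplexShape.up ℕ) k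

/-! ### Interval spheres and persistent disks -/

lemma upRel (k : ℕ) : (ComplexShape.up ℕ).Rel k (k + 1) := rfl

/-- The persistent cochain complex with `A` in degree `k`, `B` in degree `k + 1`, and with
differential `f : A ⟶ B` between them; all other degrees are zero. -/
def twoTerm {A B : PVec} (f : A ⟶ B) (k : ℕ) : PCh :=
  (HomologicalComplex.double f (upRel k)).asFunctor

/-- The map of two-term persistent complexes given by a commutative square. -/
def twoTermMap {A B A' B' : PVec} {f : A ⟶ B} {f' : A' ⟶ B'} (a : A ⟶ A') (b : B ⟶ B')
    (comm : a ≫ f' = f ≫ b) (k : ℕ) : twoTerm f k ⟶ twoTerm f' k :=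
  HomologicalComplex.complexOfFunctorsToFunctorToComplex.map
    (HomologicalComplex.mkHomFromDouble (upRel k) (Nat.succ_ne_self k).symm
      (a ≫ (HomologicalComplex.doubleXIso₀ f' (upRel k)).inv)
      (b ≫ (HomologicalComplex.doubleXIso₁ f' (upRel k) (Nat.succ_ne_self k).symm).inv)
      (by
        rw [HomologicalComplex.double_d f' (upRel k) (Nat.succ_ne_self k).symm]
        simp only [Category.assoc, Iso.inv_hom_id_assoc]
        rw [← Category.assoc, comm, Category.assoc])
      (fun l _ => by
        rw [HomologicalComplex.double_d_eq_zero₀ f' (upRel k) _ _ (Nat.succ_ne_self k),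
          comp_zero]))

/-- The interval sphere `𝕊^k_{[s,t)}`, for `s ≤ t ≤ ∞`: it is `0` at indices `r < s`, the sphere
complex `S^k` at indices `s ≤ r < t`, and the disk complex `D^k` at indices `t ≤ r`, with the
evident inclusions as structure maps. For `k ≥ 1` it is therefore the complex of persistence
modules `𝕀_{[t,∞)} ↪ 𝕀_{[s,∞)}` in degrees `k - 1` and `k`; for `k = 0`, where `D^0 = 0`, it is
`𝕀_{[s,t)}` in degree `0`. -/
def intervalSphere : (k : ℕ) → {s t : ℝ≥0∞} → s ≤ t → PCh
  | 0, s, t, _ => tensorSphere (intervalModule (halfOpen s t) (halfOpen_ordConnected s t)) 0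
  | k + 1, _, _, h => twoTerm (rayInclusion h) k

/-- The persistent disk `𝔻^k_s`: it is `0` at indices `r < s` and the disk complex `D^k` at
indices `s ≤ r`. Here `D^k` is the identity of `ℚ` in degrees `k - 1` and `k` for `k ≥ 1`, and
`D^0 = 0`. For `s = ∞` the persistent disk is zero. -/
def persistentDisk : ℕ → ℝ≥0∞ → PCh
  | 0, _ => 0
  | k + 1, s => twoTerm (𝟙 (rayModule s)) k

/-- The inclusion `𝕊^k_{[s,t)} ⟶ 𝔻^k_s` (the zero map for `k = 0`). -/
def sphereToDisk : (k : ℕ) → {s t : ℝ≥0∞} → (h : s ≤ t) →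
    (intervalSphere k h ⟶ persistentDisk k s)
  | 0, _, _, _ => 0
  | k + 1, _, _, h => twoTermMap (rayInclusion h) (𝟙 _) rfl k

/-- The inclusion `𝔻^k_t ⟶ 𝔻^k_s` for `s ≤ t`; for `t = ∞` its source is zero. -/
def diskToDisk : (k : ℕ) → {s t : ℝ≥0∞} → s ≤ t → (persistentDisk k t ⟶ persistentDisk k s)
  | 0, _, _, _ => 0
  | k + 1, _, _, h => twoTermMap (rayInclusion h) (rayInclusion h)
      (by rw [Category.comp_id, Category.id_comp]) k

/-- Indices of the generating maps: a degree `k` and endpoints `0 ≤ s < t ≤ ∞`. -/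
structure GeneratorIndex where
  k : ℕ
  s : ℝ≥0
  t : ℝ≥0∞
  lt : (s : ℝ≥0∞) < t

/-- The generating cofibrations `𝕀`: the maps `𝕊^k_{[s,t)} ⟶ 𝔻^k_s`, `0 ≤ s < t ≤ ∞`. -/
def generatingCofibrations : MorphismProperty PCh :=
  MorphismProperty.ofHoms (fun a : GeneratorIndex => sphereToDisk a.k a.lt.le)

/-- The generating trivial cofibrations `𝕁`: the maps `𝔻^k_t ⟶ 𝔻^k_s`, `0 ≤ s < t < ∞`, and
`0 ⟶ 𝔻^k_s`, `0 ≤ s < ∞` (the case `t = ∞`). -/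
def generatingTrivialCofibrations : MorphismProperty PCh :=
  MorphismProperty.ofHoms (fun a : GeneratorIndex => diskToDisk a.k a.lt.le)

/-! ### The two model structures -/

/-- The three distinguished classes of maps of a model structure. -/
structure ModelClasses (C : Type*) [Category C] where
  weakEquivalences : MorphismProperty C
  cofibrations : MorphismProperty C
  fibrations : MorphismProperty C

/-- An object is cofibrant if the map to it from the initial object is a cofibration. -/
def ModelClasses.IsCofibrant {C : Type*} [Category C] [HasInitial C] (M : ModelClasses C)
    (X : C) : Prop :=
  M.cofibrations (initial.to X)

/-- The projective model structure on cochain complexes: the weak equivalences are the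
quasi-isomorphisms, the fibrations are the degreewise surjective maps, and the cofibrations are
the maps with the left lifting property against the trivial fibrations. -/
def projectiveStructure : ModelClasses Ch where
  weakEquivalences := HomologicalComplex.quasiIso (ModuleCat.{0} ℚ) (ComplexShape.up ℕ)
  cofibrations := MorphismProperty.llp (fun _ _ f =>
    (∀ n, Function.Surjective (f.f n)) ∧
      HomologicalComplex.quasiIso (ModuleCat.{0} ℚ) (ComplexShape.up ℕ) f)
  fibrations := fun _ _ f => ∀ n, Function.Surjective (f.f n)

/-- The pointwise quasi-isomorphisms of persistent cochain complexes. -/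
def pointwiseQuasiIso : MorphismProperty PCh :=
  fun _ _ f => ∀ r : ℝ≥0, projectiveStructure.weakEquivalences (f.app r)

/-- The pointwise cofibrations of persistent cochain complexes. -/
def pointwiseCofibrations : MorphismProperty PCh :=
  fun _ _ f => ∀ r : ℝ≥0, projectiveStructure.cofibrations (f.app r)

/-- The interval-sphere model structure on persistent cochain complexes: the model structure
with the pointwise quasi-isomorphisms as weak equivalences that is cofibrantly generated by `𝕀`
and `𝕁`. Its cofibrations are the maps with the left lifting property against all `𝕀`-injective
maps, and its fibrations are the `𝕁`-injective maps. -/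
def intervalSphereStructure : ModelClasses PCh where
  weakEquivalences := pointwiseQuasiIso
  cofibrations := generatingCofibrations.rlp.llp
  fibrations := generatingTrivialCofibrations.rlp

/-- The injective model structure on persistent cochain complexes: weak equivalences and
cofibrations are pointwise, and the fibrations are the maps with the right lifting property
against the trivial cofibrations. -/
def injectiveStructure : ModelClasses PCh where
  weakEquivalences := pointwiseQuasiIso
  cofibrations := pointwiseCofibrations
  fibrations := (pointwiseCofibrations ⊓ pointwiseQuasiIso).rlp

end PersistentComplex

end

/-! Over `ℚ` every module is injective. The kernel of a surjective quasi-isomorphism of cochain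
complexes is therefore acyclic with injective terms, hence contractible, so the surjection splits;
since lifting against a split epimorphism is automatic for maps from zero, every object is
injectively cofibrant.

Evaluation in degree `k` has a right adjoint. For `k > 0` the degree `k` parts of the generating
cofibrations are zero or inclusions of free persistence modules, and these lift against the
epimorphisms whose kernel has surjective structure maps. So the degree `k` part of every
interval-sphere cofibration lifts against such an epimorphism. Take the one that sends a function
on `(r, ∞)`, where `r ≤ s`, to its germ at `s⁺`. If `𝕐` is cofibrant then the map taking an element
of `𝕐^k(r)` to the constant germ of its image in `𝕐^k(s)` lifts to functions. Such a lift takes a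
right-closed `v` at `s` to a function on `(s, ∞)` that vanishes on `(t, ∞)` for all `t > s`, hence
everywhere, so `v = 0`. -/

noncomputable section

namespace PersistentComplex

universe u v w

section

variable {C : Type*} [Category* C] [Preadditive C] {ι : Type*} {c : ComplexShape ι}

lemma isSplitMono_of_homotopy_id_zero {K A : HomologicalComplex C c} (i : K ⟶ A)
    [∀ n, IsSplitMono (i.f n)] (h : Homotopy (𝟙 K) 0) : IsSplitMono i where
  exists_splitMono := ⟨{
    retraction := Homotopy.nullHomotopicMap fun m n => retraction (i.f m) ≫ h.hom m n
    id := by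
      simp only [Homotopy.comp_nullHomotopicMap, IsSplitMono.id_assoc]
      ext n
      exact ((h.comm n).trans (add_zero _)).symm }⟩

end

section

variable {C : Type*} [Category* C] [Abelian C]

lemma nonempty_homotopy_id_zero {K : CochainComplex C ℕ} [∀ n, Injective (K.X n)]
    (hK : K.Acyclic) : Nonempty (Homotopy (𝟙 K) 0) := by
  have h0 : ((CochainComplex.single₀ C).obj 0).Acyclic := fun n =>
    ShortComplex.exact_of_isZero_X₂ _ (Functor.map_isZero (HomologicalComplex.eval _ _ n)
      (Functor.map_isZero _ (isZero_zero C)))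
  -- An acyclic complex of injectives is an injective resolution of `0`.
  let I : InjectiveResolution (0 : C) :=
    { cocomplex := K
      ι := 0
      quasiIso := ⟨fun n => (quasiIsoAt_iff_exactAt _ _ (h0 n)).2 (hK n)⟩ }
  exact ⟨InjectiveResolution.descHomotopyZero (I := I) (J := I) (𝟙 K) zero_comp⟩

lemma isSplitEpi_of_injective_kernel {A B : CochainComplex C ℕ} (p : A ⟶ B) [Epi p]
    [QuasiIso p] [∀ n, Injective ((kernel p).X n)] : IsSplitEpi p := by
  let S : ShortComplex (CochainComplex C ℕ) :=
    ShortComplex.mk (kernel.ι p) p (kernel.condition p)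
  have hS : S.ShortExact := { exact := ShortComplex.exact_kernel p }
  have (n : ℕ) : IsSplitMono ((kernel.ι p).f n) := by
    have := ((HomologicalComplex.shortExact_iff_degreewise_shortExact S).1 hS n).mono_f
    exact ⟨⟨Injective.factorThru (𝟙 _) (S.f.f n), Injective.comp_factorThru _ _⟩⟩
  obtain ⟨h⟩ := nonempty_homotopy_id_zero (hS.acyclic_X₁ ‹_›)
  have := isSplitMono_of_homotopy_id_zero (kernel.ι p) h
  exact (ShortComplex.Splitting.ofExactOfRetraction S hS.exact (retraction (kernel.ι p))
    (IsSplitMono.id _) ‹_›).isSplitEpi_g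

end

lemma isSplitEpi_of_surjective_of_quasiIso {R : Type u} [Ring R] [IsSemisimpleRing R]
    {A B : CochainComplex (ModuleCat.{max u v} R) ℕ} (p : A ⟶ B)
    (hp : ∀ n, Function.Surjective (p.f n)) [QuasiIso p] : IsSplitEpi p := by
  have (n : ℕ) : Epi (p.f n) := (ModuleCat.epi_iff_surjective _).2 (hp n)
  have := HomologicalComplex.epi_of_epi_f p this
  have (n : ℕ) : Injective ((kernel p).X n) :=
    have := Module.injective_of_isSemisimpleRing R ((kernel p).X n)
    Module.injective_object_of_injective_module R ((kernel p).X n)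
  exact isSplitEpi_of_injective_kernel p

lemma pointwiseCofibrations_initial_to (Y : PCh) : pointwiseCofibrations (initial.to Y) := by
  rintro r A B p ⟨hp, hq⟩
  have : QuasiIso p := hq
  have := isSplitEpi_of_surjective_of_quasiIso p hp
  have h0 : IsZero ((⊥_ PCh).obj r) := (Functor.isZero_iff _).1 initialIsInitial.isZero r
  exact ⟨fun {_ v} _ => ⟨⟨⟨v ≫ section_ p, h0.eq_of_src _ _, by simp⟩⟩⟩⟩

section

variable {J : Type*} [Category* J] {R : Type*} [Ring R]

/-- The epimorphisms of functors to modules whose kernel is flasque, in the sense that all its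
structure maps are surjective. -/
def episWithFlasqueKernel : MorphismProperty (J ⥤ ModuleCat.{w} R) := fun V _ q =>
  (∀ j, Function.Surjective (q.app j)) ∧
    ∀ ⦃i j : J⦄ (f : i ⟶ j) (x : V.obj j), q.app j x = 0 →
      ∃ z : V.obj i, q.app i z = 0 ∧ V.map f z = x

end

lemma mem_ray {t r : ℝ≥0} : r ∈ ray t ↔ t ≤ r := ENNReal.coe_le_coe

/-- The generator of a free persistence module. -/
def rayGenerator (t : ℝ≥0) : (rayModule t).obj t :=
  (⟨1, fun h => (h (mem_ray.2 le_rfl)).elim⟩ : intervalFiber (ray t) t)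

lemma rayModule_eq_zero {t : ℝ≥0∞} {r : ℝ≥0} (h : r ∉ ray t) (x : (rayModule t).obj r) :
    x = 0 :=
  Subtype.ext ((show intervalFiber (ray t) r from x).2 h)

lemma isZero_rayModule_top : IsZero (rayModule ⊤) :=
  Functor.isZero _ fun r =>
    have : Subsingleton ((rayModule ⊤).obj r) :=
      subsingleton_of_forall_eq 0 (rayModule_eq_zero fun h =>
        ENNReal.coe_ne_top (top_le_iff.1 h))
    ModuleCat.isZero_of_subsingleton _

lemma rayModule_eq_smul {t r : ℝ≥0} (h : t ≤ r) (x : (rayModule t).obj r) :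
    x = (show intervalFiber (ray t) r from x).1 •
      (rayModule t).map (homOfLE h) (rayGenerator t) := by
  apply Subtype.ext
  exact (mul_one _).symm.trans (congrArg (_ * ·) (if_pos (mem_ray.2 h)).symm)

lemma rayModule_hom_ext {t : ℝ≥0} {V : PVec} {f g : rayModule t ⟶ V}
    (h : f.app t (rayGenerator t) = g.app t (rayGenerator t)) : f = g := by
  ext r x
  by_cases hr : t ≤ r
  · rw [rayModule_eq_smul hr x, map_smul, map_smul, NatTrans.naturality_apply,
      NatTrans.naturality_apply, h]
  · rw [rayModule_eq_zero (mt mem_ray.1 hr) x, map_zero, map_zero]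

/-- The component at `r` of `rayHom m`: it is `q ↦ q • m` at the indices `r ≥ t`, and zero at the
others. -/
def rayHomComponent {t : ℝ≥0} {V : PVec} (m : V.obj t) (r : ℝ≥0) :
    intervalFiber (ray t) r →ₗ[ℚ] V.obj r :=
  if h : t ≤ r then (LinearMap.toSpanSingleton ℚ (V.obj r) (V.map (homOfLE h) m)).comp
    (intervalFiber (ray t) r).subtype else 0

lemma rayHomComponent_apply {t : ℝ≥0} {V : PVec} (m : V.obj t) {r : ℝ≥0} (h : t ≤ r)
    (x : intervalFiber (ray t) r) : rayHomComponent m r x = x.1 • V.map (homOfLE h) m := by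
  rw [rayHomComponent, dif_pos h]
  rfl

/-- The map from a free persistence module that sends the generator to `m`. -/
def rayHom {t : ℝ≥0} {V : PVec} (m : V.obj t) : rayModule t ⟶ V where
  app r := ModuleCat.ofHom (rayHomComponent m r)
  naturality r r' f := by
    refine ModuleCat.hom_ext <| LinearMap.ext fun (x : intervalFiber (ray t) r) => ?_
    change rayHomComponent m r' (fiberMap (ray t) (ray t) r r' x) =
      V.map f (rayHomComponent m r x)
    by_cases h : t ≤ r
    · have h' := h.trans (leOfHom f)
      rw [rayHomComponent_apply m h, rayHomComponent_apply m h', map_smul,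
        ← ConcreteCategory.comp_apply, ← V.map_comp]
      exact congrArg (· • _) (if_pos (mem_ray.2 h'))
    · obtain rfl : x = 0 := rayModule_eq_zero (mt mem_ray.1 h) x
      simp only [map_zero]

lemma rayHom_generator {t : ℝ≥0} {V : PVec} (m : V.obj t) :
    (rayHom m).app t (rayGenerator t) = m := by
  refine (rayHomComponent_apply m le_rfl _).trans ?_
  change (1 : ℚ) • V.map (𝟙 t) m = m
  rw [one_smul, V.map_id]
  rfl

lemma rayInclusion_generator {s t : ℝ≥0} (h : (s : ℝ≥0∞) ≤ t) :
    (rayInclusion h).app t (rayGenerator t) =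
      (rayModule s).map (homOfLE (ENNReal.coe_le_coe.1 h)) (rayGenerator s) := rfl

lemma rayInclusion_hasLiftingProperty {V W : PVec} {q : V ⟶ W} (hq : episWithFlasqueKernel q)
    {s : ℝ≥0} {t : ℝ≥0∞} (h : (s : ℝ≥0∞) ≤ t) : HasLiftingProperty (rayInclusion h) q where
  sq_hasLift {a b} sq := by
    obtain ⟨x, hx⟩ := hq.1 s (b.app s (rayGenerator s))
    induction t with
    | top =>
      refine ⟨⟨rayHom x, isZero_rayModule_top.eq_of_src _ _, rayModule_hom_ext ?_⟩⟩
      rw [NatTrans.comp_app, ConcreteCategory.comp_apply, rayHom_generator, hx]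
    | coe t =>
      have hst : s ≤ t := ENNReal.coe_le_coe.1 h
      have hker : q.app t (a.app t (rayGenerator t) - V.map (homOfLE hst) x) = 0 := by
        have e := ConcreteCategory.congr_hom (NatTrans.congr_app sq.w t) (rayGenerator t)
        rw [NatTrans.comp_app, NatTrans.comp_app, ConcreteCategory.comp_apply,
          ConcreteCategory.comp_apply, rayInclusion_generator, NatTrans.naturality_apply] at e
        rw [map_sub, NatTrans.naturality_apply, hx, e, sub_self]
      -- The kernel element `z` corrects the lift `x` of the bottom map to one of the top map too.
      obtain ⟨z, hz, hz'⟩ := hq.2 (homOfLE hst) _ hker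
      refine ⟨⟨rayHom (x + z), rayModule_hom_ext ?_, rayModule_hom_ext ?_⟩⟩
      · rw [NatTrans.comp_app, ConcreteCategory.comp_apply, rayInclusion_generator,
          NatTrans.naturality_apply, rayHom_generator, map_add, hz', add_sub_cancel]
      · rw [NatTrans.comp_app, ConcreteCategory.comp_apply, rayHom_generator, map_add, hx, hz,
          add_zero]

lemma eval_isLeftAdjoint {C : Type u} [Category.{v} C] [Abelian C] [IsGrothendieckAbelian.{v} C]
    {ι : Type v} (c : ComplexShape ι) [c.HasNoLoop] (i : ι) :
    (HomologicalComplex.eval C c i).IsLeftAdjoint :=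
  have : PreservesColimitsOfSize.{v, v} (HomologicalComplex.eval C c i) := ⟨inferInstance⟩
  isLeftAdjoint_of_preservesColimits_of_isSeparating
    (isSeparator_separator (HomologicalComplex C c)) _

/-- The functor of `k`-cochains of persistent complexes; on objects it is `cochains`. -/
def cochainsFunctor (k : ℕ) : PCh ⥤ PVec :=
  (Functor.whiskeringRight ℝ≥0 Ch (ModuleCat.{0} ℚ)).obj
    (HomologicalComplex.eval (ModuleCat.{0} ℚ) (ComplexShape.up ℕ) k)

instance (k : ℕ) : (cochainsFunctor k).IsLeftAdjoint :=
  have := eval_isLeftAdjoint (C := ModuleCat.{0} ℚ) (ComplexShape.up ℕ) k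
  ⟨_, ⟨(Adjunction.ofIsLeftAdjoint _).whiskerRight ℝ≥0⟩⟩

lemma twoTermMap_hasLiftingProperty {A B A' B' V W : PVec} {f : A ⟶ B} {f' : A' ⟶ B'}
    (a : A ⟶ A') (b : B ⟶ B') (comm : a ≫ f' = f ≫ b) (j : ℕ) (q : V ⟶ W)
    [HasLiftingProperty a q] [HasLiftingProperty b q] (k : ℕ) :
    HasLiftingProperty ((cochainsFunctor k).map (twoTermMap a b comm j)) q := by
  have hne : j ≠ j + 1 := (Nat.succ_ne_self j).symm
  by_cases h0 : k = j
  · subst h0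
    refine HasLiftingProperty.of_arrow_iso_left
      (Arrow.isoMk (HomologicalComplex.doubleXIso₀ f (upRel k)).symm
        (HomologicalComplex.doubleXIso₀ f' (upRel k)).symm ?_ :
        Arrow.mk a ≅ Arrow.mk ((cochainsFunctor k).map (twoTermMap a b comm k))) q
    change (HomologicalComplex.doubleXIso₀ f (upRel k)).inv ≫
      (HomologicalComplex.mkHomFromDouble _ _ _ _ _ _).f k = a ≫ _
    rw [HomologicalComplex.mkHomFromDouble_f₀, Iso.inv_hom_id_assoc]
    rfl
  by_cases h1 : k = j + 1
  · subst h1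
    refine HasLiftingProperty.of_arrow_iso_left
      (Arrow.isoMk (HomologicalComplex.doubleXIso₁ f (upRel j) hne).symm
        (HomologicalComplex.doubleXIso₁ f' (upRel j) hne).symm ?_ :
        Arrow.mk b ≅ Arrow.mk ((cochainsFunctor (j + 1)).map (twoTermMap a b comm j))) q
    change (HomologicalComplex.doubleXIso₁ f (upRel j) hne).inv ≫
      (HomologicalComplex.mkHomFromDouble _ _ _ _ _ _).f (j + 1) = b ≫ _
    rw [HomologicalComplex.mkHomFromDouble_f₁, Iso.inv_hom_id_assoc]
    rfl
  · have : IsIso ((cochainsFunctor k).map (twoTermMap a b comm j)) :=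
      (HomologicalComplex.isZero_double_X f (upRel j) k h0 h1).isIso
        (HomologicalComplex.isZero_double_X f' (upRel j) k h0 h1) _
    infer_instance

lemma isZero_cochains_tensorSphere (V : PVec) {j k : ℕ} (h : k ≠ j) :
    IsZero (cochains (tensorSphere V j) k) :=
  Functor.isZero _ fun r =>
    HomologicalComplex.isZero_single_obj_X (ComplexShape.up ℕ) j (V.obj r) k h

lemma cochains_sphereToDisk_hasLiftingProperty {V W : PVec} {q : V ⟶ W}
    (hq : episWithFlasqueKernel q) {k : ℕ} (hk : 0 < k) (j : ℕ) {s : ℝ≥0} {t : ℝ≥0∞}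
    (h : (s : ℝ≥0∞) ≤ t) : HasLiftingProperty ((cochainsFunctor k).map (sphereToDisk j h)) q := by
  cases j with
  | zero =>
    have : IsIso ((cochainsFunctor k).map (sphereToDisk 0 h)) :=
      (isZero_cochains_tensorSphere _ hk.ne').isIso
        ((cochainsFunctor k).map_isZero (isZero_zero PCh)) _
    infer_instance
  | succ j =>
    have := rayInclusion_hasLiftingProperty hq h
    exact twoTermMap_hasLiftingProperty _ _ rfl j q k

lemma cochains_hasLiftingProperty_of_cofibrations {X Y : PCh} {i : X ⟶ Y}
    (hi : intervalSphereStructure.cofibrations i) {k : ℕ} (hk : 0 < k) {V W : PVec} {q : V ⟶ W}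
    (hq : episWithFlasqueKernel q) : HasLiftingProperty ((cochainsFunctor k).map i) q := by
  let adj := Adjunction.ofIsLeftAdjoint (cochainsFunctor k)
  refine (adj.hasLiftingProperty_iff _ _).2 (hi _ ?_)
  rintro _ _ _ ⟨a⟩
  exact (adj.hasLiftingProperty_iff _ _).1
    (cochains_sphereToDisk_hasLiftingProperty hq hk a.k a.lt.le)

section

variable {R : Type u} [Ring R] {J : Type w} [Category.{v} J]

/-- The cofree functor on a module `M` at the index `s`, with value `M ^ (r ⟶ s)` at `r`. -/
def cofree (s : J) (M : Type v) [AddCommGroup M] [Module R M] : J ⥤ ModuleCat.{v} R where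
  obj r := ModuleCat.of R ((r ⟶ s) → M)
  map f := ModuleCat.ofHom (LinearMap.funLeft R M fun g => f ≫ g)

/-- The map to a cofree functor that corresponds to a linear map on the value at `s`. -/
def toCofree {V : J ⥤ ModuleCat.{v} R} {s : J} {M : Type v} [AddCommGroup M] [Module R M]
    (l : V.obj s →ₗ[R] M) : V ⟶ cofree s M where
  app r := ModuleCat.ofHom (LinearMap.pi fun g => l ∘ₗ (V.map g).hom)
  naturality r r' f := by
    ext x
    exact funext fun g => congrArg l (ConcreteCategory.congr_hom (V.map_comp f g) x).symm

end

section

variable {R : Type u} [Ring R] {ι : Type v} [LinearOrder ι] {M : Type v} [AddCommGroup M]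
  [Module R M] {r s t : ι}

variable (R M) in
/-- The persistence module of `M`-valued functions on the open rays `(s, ∞)`, with restriction as
structure maps. -/
def rightFunctions : ι ⥤ ModuleCat.{v} R where
  obj s := ModuleCat.of R (Set.Ioi s → M)
  map f := ModuleCat.ofHom
    (LinearMap.funLeft R M (Set.inclusion (Set.Ioi_subset_Ioi (leOfHom f))))

lemma exists_extension_by_zero (f : s ⟶ t) (x : (rightFunctions R M).obj t) :
    ∃ z : Set.Ioi s → M, (rightFunctions R M).map f z = x ∧ ∀ u, u.1 ≤ t → z u = 0 := by
  classical
  exact ⟨fun u => if hu : t < u then x ⟨u, hu⟩ else 0, funext fun u => dif_pos u.2,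
    fun u hu => dif_neg hu.not_gt⟩

variable (R M) in
/-- The germ at `s⁺` of a function on `(s, ∞)`. -/
def germAbove (s : ι) : (Set.Ioi s → M) →ₗ[R] (Filter.atBot : Filter (Set.Ioi s)).Germ M where
  toFun := (↑)
  map_add' _ _ := rfl
  map_smul' _ _ := rfl

variable (R M) in
/-- The map that sends a function on `(r, ∞)`, where `r ≤ s`, to its germ at `s⁺`; at the indices
`r > s` its target is zero. -/
def toGermsAbove (s : ι) :
    rightFunctions R M ⟶ cofree s ((Filter.atBot : Filter (Set.Ioi s)).Germ M) :=
  toCofree (germAbove R M s)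

lemma toGermsAbove_surjective (s r : ι) : Function.Surjective ((toGermsAbove R M s).app r) := by
  intro w
  by_cases h : r ≤ s
  · obtain ⟨x, hx⟩ := Quotient.exists_rep (w (homOfLE h))
    obtain ⟨z, hz, -⟩ := exists_extension_by_zero (R := R) (homOfLE h) x
    exact ⟨z, funext fun _ => (congrArg (germAbove R M s) hz).trans hx⟩
  · exact ⟨0, funext fun g => (h (leOfHom g)).elim⟩

lemma exists_lift_of_toGermsAbove_eq_zero (f : r ⟶ t) (x : (rightFunctions R M).obj t)
    (hx : (toGermsAbove R M s).app t x = 0) :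
    ∃ z, (toGermsAbove R M s).app r z = 0 ∧ (rightFunctions R M).map f z = x := by
  obtain ⟨z, hz, hz0⟩ := exists_extension_by_zero f x
  refine ⟨z, funext fun g => ?_, hz⟩
  obtain hts | hst := le_or_gt t s
  · subst hz
    exact congrFun hx (homOfLE hts)
  · refine Filter.Germ.coe_eq.2 ?_
    filter_upwards [Filter.eventually_le_atBot (⟨t, hst⟩ : Set.Ioi s)] with u hu
    exact hz0 _ hu

lemma episWithFlasqueKernel_toGermsAbove (s : ι) :
    episWithFlasqueKernel (toGermsAbove R M s) :=
  ⟨toGermsAbove_surjective s, fun _ _ => exists_lift_of_toGermsAbove_eq_zero⟩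

lemma app_eq_zero_of_forall_map_eq_zero [DenselyOrdered ι] {V : ι ⥤ ModuleCat.{v} R}
    (φ : V ⟶ rightFunctions R M) {v : V.obj s}
    (hv : ∀ t (h : s < t), V.map (homOfLE h.le) v = 0) : φ.app s v = 0 := by
  funext u
  obtain ⟨t, hst, htu⟩ := exists_between (show s < u from u.2)
  have h := φ.naturality_apply (homOfLE hst.le) v
  rw [hv t hst, map_zero] at h
  exact (congrFun h ⟨u, htu⟩).symm

/-- The map that sends an element of `V.obj r`, where `r ≤ s`, to the constant germ at `s⁺` of its
image in `V.obj s`. -/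
def constGermAbove (V : ι ⥤ ModuleCat.{v} R) (s : ι) :
    V ⟶ cofree s ((Filter.atBot : Filter (Set.Ioi s)).Germ (V.obj s)) :=
  toCofree (germAbove R (V.obj s) s ∘ₗ LinearMap.pi fun _ => LinearMap.id)

lemma eq_zero_of_comp_toGermsAbove [DenselyOrdered ι] [NoMaxOrder ι] {V : ι ⥤ ModuleCat.{v} R}
    {φ : V ⟶ rightFunctions R (V.obj s)} (hφ : φ ≫ toGermsAbove R _ s = constGermAbove V s)
    {v : V.obj s} (hv : ∀ t (h : s < t), V.map (homOfLE h.le) v = 0) : v = 0 := by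
  have hconst : (constGermAbove V s).app s v = 0 := by
    rw [← hφ, NatTrans.comp_app, ConcreteCategory.comp_apply,
      app_eq_zero_of_forall_map_eq_zero φ hv, map_zero]
  have h : germAbove R _ s (fun _ => V.map (𝟙 s) v) = germAbove R _ s (fun _ => 0) :=
    congrFun hconst (𝟙 s)
  simpa using Filter.Germ.const_inj.1 h

end

lemma not_isCofibrant_of_isRightClosed (Y : PCh) {k : ℕ} (hk : 0 < k) {s : ℝ≥0}
    {y : (cochains Y k).obj s} (hy : IsRightClosed (cochains Y k) s y) :
    ¬ intervalSphereStructure.IsCofibrant Y := by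
  intro hY
  let V := (cochainsFunctor k).obj Y
  have := cochains_hasLiftingProperty_of_cofibrations hY hk
    (episWithFlasqueKernel_toGermsAbove (R := ℚ) (M := V.obj s) s)
  have h0 : IsZero ((cochainsFunctor k).obj (⊥_ PCh)) :=
    (cochainsFunctor k).map_isZero initialIsInitial.isZero
  have sq : CommSq (h0.to_ _) ((cochainsFunctor k).map (initial.to Y))
    (toGermsAbove ℚ (V.obj s) s) (constGermAbove V s) := ⟨h0.eq_of_src _ _⟩
  exact hy.1 (eq_zero_of_comp_toGermsAbove sq.fac_right hy.2)

lemma IsRightClosed.map {V W : PVec} (f : V ⟶ W) [Mono f] {r : ℝ≥0} {v : V.obj r}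
    (hv : IsRightClosed V r v) : IsRightClosed W r (f.app r v) := by
  have hf := (ModuleCat.mono_iff_injective (f.app r)).1 inferInstance
  refine ⟨(map_ne_zero_iff _ hf).2 hv.1, fun r' h => ?_⟩
  rw [← NatTrans.naturality_apply, hv.2 r' h, map_zero]

lemma exists_isRightClosed_closedIntervalModule {s t : ℝ≥0} (h : s ≤ t) :
    ∃ v, IsRightClosed (closedIntervalModule s t) t v :=
  ⟨(⟨1, fun hn => (hn ⟨h, le_rfl⟩).elim⟩ : intervalFiber (Set.Icc s t) t),
    fun h0 => one_ne_zero (congrArg Subtype.val h0),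
    fun _ hr => Subtype.ext (if_neg fun hm => not_le.2 hr hm.2)⟩

/-- The degree `k` part of `V ⊗ S^k` is `V`. -/
def cochainsTensorSphereIso (V : PVec) (k : ℕ) : cochains (tensorSphere V k) k ≅ V :=
  Functor.isoWhiskerLeft V
    (HomologicalComplex.singleCompEvalIsoSelf (ModuleCat.{0} ℚ) (ComplexShape.up ℕ) k)

lemma not_isCofibrant_closedInterval {s t : ℝ≥0} {k : ℕ} (h : s ≤ t) (hk : 0 < k) :
    ¬ intervalSphereStructure.IsCofibrant (tensorSphere (closedIntervalModule s t) k) :=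
  have ⟨_, hv⟩ := exists_isRightClosed_closedIntervalModule h
  not_isCofibrant_of_isRightClosed _ hk (hv.map (cochainsTensorSphereIso _ k).inv)

lemma cofibrations_ne :
    intervalSphereStructure.cofibrations ≠ injectiveStructure.cofibrations := fun h =>
  not_isCofibrant_closedInterval (le_refl 0) one_pos <| by
    rw [ModelClasses.IsCofibrant, h]
    exact pointwiseCofibrations_initial_to _

end PersistentComplex

end

theorem mainTheorem5 :
    (∀ (Y : PersistentComplex.PCh) (k : ℕ), 0 < k →
      (∃ (s : ℝ≥0) (y : (PersistentComplex.cochains Y k).obj s),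
        PersistentComplex.IsRightClosed (PersistentComplex.cochains Y k) s y) →
      ¬ PersistentComplex.intervalSphereStructure.IsCofibrant Y) ∧
    (∀ (s t : ℝ≥0) (k : ℕ), s ≤ t → 0 < k →
      ¬ PersistentComplex.intervalSphereStructure.IsCofibrant
        (PersistentComplex.tensorSphere (PersistentComplex.closedIntervalModule s t) k)) ∧
    (∀ Y : PersistentComplex.PCh, PersistentComplex.injectiveStructure.IsCofibrant Y) ∧
    PersistentComplex.intervalSphereStructure.cofibrations ≠
      PersistentComplex.injectiveStructure.cofibrations ∧
    PersistentComplex.intervalSphereStructure ≠ PersistentComplex.injectiveStructure :=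
  ⟨fun Y _ hk ⟨_, _, hy⟩ => PersistentComplex.not_isCofibrant_of_isRightClosed Y hk hy,
    fun _ _ _ h hk => PersistentComplex.not_isCofibrant_closedInterval h hk,
    PersistentComplex.pointwiseCofibrations_initial_to,
    PersistentComplex.cofibrations_ne,
    fun h => PersistentComplex.cofibrations_ne (congrArg _ h)⟩
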